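/- A relational schema is a set of relation symbols, each with a fixed arity. The unary-negation fragment UNFO of first-order logic over a relational schema consists of the formulas given by the grammar $$\varphi ::= R(\bar x) \mid x = y \mid \varphi\wedge\varphi \mid \varphi\vee\varphi \mid \exists x\,\varphi \mid \neg\varphi(x),$$ where $R$ ranges over the relation symbols of the schema and where, in the last clause, $\varphi(x)$ has no free variables besides possibly $x$ (that is, only formulas with at most one free variable may be negated). Theorem. Every satisfiable UNFO formula has a finite model. That is, if $\varphi(\bar x)$ is a UNFO formula and $M\models\varphi(\bar a)$ for some structure $M$ with non-empty domain and some tuple $\bar a$ of elements of $M$, then $N\models\varphi(\bar b)$ for some structure $N$ over the same schema with finite non-empty domain and some tuple $\bar b$ of elements of $N$. -/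

import Mathlib

universe u v w z

namespace UNFO

/-- The formula `φ`, whose free variables are indexed by `α` (named variables) and by `Fin n`
(variables in the scope of the enclosing quantifiers), has at most one free variable. -/
def AtMostOneFree {L : FirstOrder.Language.{u, v}} {α : Type w} {n : ℕ} (φ : L.BoundedFormula α n) : Prop :=
  by classical exact φ.toFormula.freeVarFinset.card ≤ 1

/-- The unary-negation fragment of first-order logic over a relational language `L` (there, every
term is a variable): the formulas built from relational atoms and equalities by means of
conjunction, disjunction, existential quantification, and negation of formulas that have at most
one free variable. -/
inductive IsUNFO {L : FirstOrder.Language.{u, v}} [L.IsRelational] {α : Type w} :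
    ∀ {n : ℕ}, L.BoundedFormula α n → Prop
  | rel {n k : ℕ} (R : L.Relations k) (x : Fin k → L.Term (α ⊕ Fin n)) :
      IsUNFO (R.boundedFormula x)
  | equal {n : ℕ} (x y : L.Term (α ⊕ Fin n)) : IsUNFO (x.bdEqual y)
  | and {n : ℕ} {φ ψ : L.BoundedFormula α n} : IsUNFO φ → IsUNFO ψ → IsUNFO (φ ⊓ ψ)
  | or {n : ℕ} {φ ψ : L.BoundedFormula α n} : IsUNFO φ → IsUNFO ψ → IsUNFO (φ ⊔ ψ)
  | ex {n : ℕ} {φ : L.BoundedFormula α (n + 1)} : IsUNFO φ → IsUNFO φ.ex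
  | not {n : ℕ} {φ : L.BoundedFormula α n} : AtMostOneFree φ → IsUNFO φ → IsUNFO φ.not

/-- `φ` is true in some structure (with a non-empty domain in the universe `z`) under some
assignment of elements to its free variables. -/
def IsSatisfiable {L : FirstOrder.Language.{u, v}} {α : Type w} (φ : L.Formula α) : Prop :=
  ∃ (M : Type z) (_ : L.Structure M) (_ : Nonempty M) (a : α → M), φ.Realize a

/-- `φ` is true in some finite structure (with a non-empty domain) under some assignment of
elements to its free variables. -/
def HasFiniteModel {L : FirstOrder.Language.{u, v}} {α : Type w} (φ : L.Formula α) : Prop :=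
  ∃ (M : Type) (_ : L.Structure M) (_ : Nonempty M) (_ : Finite M) (a : α → M), φ.Realize a

end UNFO

/-! Since only formulas with at most one free variable are negated, truth passes along maps that
preserve relations on a small set and send its elements to game-equivalent ones
(`IsUNFO.exists_witness`). It remains to match `M` with a finite structure in a bounded game.

Only finitely many relations matter, so tuples of `M` have finitely many types (pattern and codes),
each represented by a bag. Gluing bags at elements of equal code unfolds `M` into an infinite tree;
`Vertex` folds it by keeping only the latest letter at each of `k + 2` cyclic levels. A vertex and
`k` others miss some level. Cut there, histories can be traced in `M`, which gives a homomorphism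
(`Vertex.homOn_proj`). Each traced step costs one rank of code, at most `k + 1` in all, so enough
initial rank wins the game (`Vertex.sim`). -/

namespace UNFO

open FirstOrder FirstOrder.Language

/-! ### The bisimulation game -/

section Game

variable {L : FirstOrder.Language.{u, v}} (σ : Set (Σ n, L.Relations n))

/-- `h` preserves the relations in `σ` on tuples of elements of `s`. -/
def HomOn {A : Type w} {B : Type z} [L.Structure A] [L.Structure B] (s : Set A) (h : A → B) :
    Prop :=
  ∀ R ∈ σ, ∀ x : Fin R.1 → A, (∀ t, x t ∈ s) →
    Structure.RelMap R.2 x → Structure.RelMap R.2 (h ∘ x)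

/-- The `r`-round unary-negation bisimulation game with at most `k` pebbles. -/
def Sim (k : ℕ) (A B : Type z) [L.Structure A] [L.Structure B] : ℕ → A → B → Prop
  | 0, _, _ => True
  | r + 1, a, b =>
    (∀ s : Finset A, s.card ≤ k →
      ∃ h : A → B, h a = b ∧ HomOn σ (s : Set A) h ∧ ∀ x ∈ s, Sim k A B r x (h x)) ∧
    (∀ s : Finset B, s.card ≤ k →
      ∃ h : B → A, h b = a ∧ HomOn σ (s : Set B) h ∧ ∀ x ∈ s, Sim k A B r (h x) x)

theorem Sim.symm {k : ℕ} {A B : Type z} [L.Structure A] [L.Structure B] {r : ℕ} :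
    ∀ {a : A} {b : B}, Sim σ k A B r a b → Sim σ k B A r b a := by
  induction r with
  | zero => intros; trivial
  | succ r ih =>
    intro a b h
    refine ⟨fun s hs => ?_, fun s hs => ?_⟩
    · obtain ⟨f, h1, h2, h3⟩ := h.2 s hs
      exact ⟨f, h1, h2, fun x hx => ih (h3 x hx)⟩
    · obtain ⟨f, h1, h2, h3⟩ := h.1 s hs
      exact ⟨f, h1, h2, fun x hx => ih (h3 x hx)⟩

end Game

/-! ### Preservation of unary-negation formulas -/

section Preservation

variable {L : FirstOrder.Language.{u, v}}

theorem realize_congr_of_freeVar {β : Type w} [DecidableEq β] (φ : L.Formula β) {A : Type z}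
    [L.Structure A] {v v' : β → A} (h : ∀ x ∈ φ.freeVarFinset, v x = v' x) :
    φ.Realize v ↔ φ.Realize v' := by
  unfold Formula.Realize
  rw [← BoundedFormula.realize_restrictFreeVar' (s := (φ.freeVarFinset : Set β)) subset_rfl,
    ← BoundedFormula.realize_restrictFreeVar' (s := (φ.freeVarFinset : Set β)) subset_rfl]
  have : (v ∘ (↑) : ↥(φ.freeVarFinset : Set β) → A) = v' ∘ (↑) := funext fun x => h x x.2
  rw [this]

/-- The restriction on negation enters here: a round trip through another structure need only fix
the value of the single free variable. -/
theorem AtMostOneFree.exists_realize_congr {α : Type w} {n : ℕ} {φ : L.BoundedFormula α n}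
    (hφ : AtMostOneFree φ) {A : Type z} [L.Structure A] [Nonempty A] (v : α → A) (xs : Fin n → A) :
    ∃ a : A, ∀ f : A → A, f a = a → (φ.Realize (f ∘ v) (f ∘ xs) ↔ φ.Realize v xs) := by
  classical
  have hφ' : φ.toFormula.freeVarFinset.card ≤ 1 := by
    unfold AtMostOneFree at hφ
    convert hφ
  obtain ⟨a, ha⟩ : ∃ a : A, ∀ x ∈ φ.toFormula.freeVarFinset, Sum.elim v xs x = a := by
    rcases Finset.eq_empty_or_nonempty φ.toFormula.freeVarFinset with h | ⟨x, hx⟩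
    · exact ⟨Classical.arbitrary A, by simp [h]⟩
    · exact ⟨Sum.elim v xs x, fun y hy => by rw [Finset.card_le_one.1 hφ' y hy x hx]⟩
  refine ⟨a, fun f hf => ?_⟩
  have key := realize_congr_of_freeVar φ.toFormula (v := f ∘ Sum.elim v xs) (v' := Sum.elim v xs)
    (fun x hx => by rw [Function.comp_apply, ha x hx, hf])
  rw [BoundedFormula.realize_toFormula, BoundedFormula.realize_toFormula] at key
  exact key

theorem realize_term_comp [L.IsRelational] {β : Type w} {A B : Type z} [L.Structure A]
    [L.Structure B] (h : A → B) (v : β → A) (t : L.Term β) :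
    t.realize (h ∘ v) = h (t.realize v) := by
  rcases t with y | ⟨f, _⟩
  · rfl
  · exact isEmptyElim f

/-- A unary-negation formula true in a structure has a small witness set in it: every map into
another structure that preserves relations on this set and sends its elements to
game-equivalent ones preserves the truth of the formula. -/
theorem IsUNFO.exists_witness [L.IsRelational] {α : Type w} {n : ℕ} {φ : L.BoundedFormula α n}
    (hφ : IsUNFO φ) :
    ∃ (K r : ℕ) (σ : Set (Σ n, L.Relations n)), σ.Finite ∧
      ∀ (k : ℕ) (_ : K ≤ k) (r' : ℕ) (_ : r ≤ r') (τ : Set (Σ n, L.Relations n)) (_ : σ ⊆ τ)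
        (A B : Type z) [L.Structure A] [L.Structure B] [Nonempty A] (v : α → A) (xs : Fin n → A),
        φ.Realize v xs → ∃ s : Finset A, s.card ≤ K ∧
          ∀ h : A → B, HomOn τ (s : Set A) h → (∀ a ∈ s, Sim τ k A B r' a (h a)) →
            φ.Realize (h ∘ v) (h ∘ xs) := by
  classical
  induction hφ with
  | @rel n m R x =>
    refine ⟨m, 0, {⟨m, R⟩}, Set.finite_singleton _, ?_⟩
    intro k _ r' _ τ hτ A B _ _ _ v xs hA
    rw [BoundedFormula.realize_rel] at hA
    refine ⟨Finset.univ.image fun i => (x i).realize (Sum.elim v xs),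
      Finset.card_image_le.trans (by simp), fun h hh _ => ?_⟩
    have := hh ⟨m, R⟩ (hτ rfl) (fun i => (x i).realize (Sum.elim v xs)) (by simp) hA
    rw [BoundedFormula.realize_rel, ← Sum.comp_elim]
    simp only [realize_term_comp]
    exact this
  | @equal n x y =>
    refine ⟨0, 0, ∅, Set.finite_empty, ?_⟩
    intro k _ r' _ τ hτ A B _ _ _ v xs hA
    rw [BoundedFormula.realize_bdEqual] at hA
    refine ⟨∅, by simp, fun h _ _ => ?_⟩
    rw [BoundedFormula.realize_bdEqual, ← Sum.comp_elim, realize_term_comp, realize_term_comp, hA]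
  | and _ _ ih₁ ih₂ =>
    obtain ⟨K₁, r₁, σ₁, f₁, h₁⟩ := ih₁
    obtain ⟨K₂, r₂, σ₂, f₂, h₂⟩ := ih₂
    refine ⟨K₁ + K₂, max r₁ r₂, σ₁ ∪ σ₂, f₁.union f₂, ?_⟩
    intro k hk r' hr τ hτ A B _ _ _ v xs hA
    rw [BoundedFormula.realize_inf] at hA
    obtain ⟨s₁, c₁, w₁⟩ := h₁ k (by omega) r' (le_of_max_le_left hr) τ
      (Set.subset_union_left.trans hτ) A B v xs hA.1
    obtain ⟨s₂, c₂, w₂⟩ := h₂ k (by omega) r' (le_of_max_le_right hr) τ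
      (Set.subset_union_right.trans hτ) A B v xs hA.2
    refine ⟨s₁ ∪ s₂, (Finset.card_union_le _ _).trans (by omega), fun h hh hs => ?_⟩
    rw [BoundedFormula.realize_inf]
    exact ⟨w₁ h (fun R hR x hx => hh R hR x fun t => Finset.mem_union_left _ (hx t))
        fun a ha => hs a (Finset.mem_union_left _ ha),
      w₂ h (fun R hR x hx => hh R hR x fun t => Finset.mem_union_right _ (hx t))
        fun a ha => hs a (Finset.mem_union_right _ ha)⟩
  | or _ _ ih₁ ih₂ =>
    obtain ⟨K₁, r₁, σ₁, f₁, h₁⟩ := ih₁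
    obtain ⟨K₂, r₂, σ₂, f₂, h₂⟩ := ih₂
    refine ⟨K₁ + K₂, max r₁ r₂, σ₁ ∪ σ₂, f₁.union f₂, ?_⟩
    intro k hk r' hr τ hτ A B _ _ _ v xs hA
    rw [BoundedFormula.realize_sup] at hA
    rcases hA with hA | hA
    · obtain ⟨s₁, c₁, w₁⟩ := h₁ k (by omega) r' (le_of_max_le_left hr) τ
        (Set.subset_union_left.trans hτ) A B v xs hA
      exact ⟨s₁, by omega, fun h hh hs => BoundedFormula.realize_sup.2 (Or.inl (w₁ h hh hs))⟩
    · obtain ⟨s₂, c₂, w₂⟩ := h₂ k (by omega) r' (le_of_max_le_right hr) τ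
        (Set.subset_union_right.trans hτ) A B v xs hA
      exact ⟨s₂, by omega, fun h hh hs => BoundedFormula.realize_sup.2 (Or.inr (w₂ h hh hs))⟩
  | ex _ ih =>
    obtain ⟨K, r, σ, f, h⟩ := ih
    refine ⟨K, r, σ, f, ?_⟩
    intro k hk r' hr τ hτ A B _ _ _ v xs hA
    rw [BoundedFormula.realize_ex] at hA
    obtain ⟨a, hA⟩ := hA
    obtain ⟨s, c, w⟩ := h k hk r' hr τ hτ A B v _ hA
    refine ⟨s, c, fun g hg hs => BoundedFormula.realize_ex.2 ⟨g a, ?_⟩⟩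
    rw [← Fin.comp_snoc]
    exact w g hg hs
  | not h1 _ ih =>
    obtain ⟨K, r, σ, f, h⟩ := ih
    -- The `+ 1` in size makes room for `{a}` when `K = 0`; the extra round pulls a witness set
    -- found in `B` back to `A`.
    refine ⟨K + 1, r + 1, σ, f, ?_⟩
    intro k hk r' hr τ hτ A B _ _ _ v xs hA
    rw [BoundedFormula.realize_not] at hA
    obtain ⟨a, ha⟩ := h1.exists_realize_congr v xs
    refine ⟨{a}, by simp, fun g _ hs => ?_⟩
    rw [BoundedFormula.realize_not]
    intro hB
    obtain ⟨r', rfl⟩ : ∃ r'', r' = r'' + 1 := ⟨r' - 1, by omega⟩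
    have : Nonempty B := ⟨g a⟩
    obtain ⟨s, c, w⟩ := h k (by omega) r' (by omega) τ hτ B A _ _ hB
    obtain ⟨g', e1, e2, e3⟩ := (hs a (by simp)).2 s (by omega)
    exact hA ((ha (g' ∘ g) e1).1 (w g' e2 fun b hb => (e3 b hb).symm))

end Preservation

/-! ### Bounded-rank types of elements -/

section Codes

/-- Codes of elements of rank `r`, for tuples of length `k` and patterns in `Q`. -/
def Code (Q : Type u) (k : ℕ) : ℕ → Type u
  | 0 => PUnit
  | r + 1 => Set (Q × (Fin k → Code Q k r))

instance Code.instFinite (Q : Type u) [Finite Q] (k r : ℕ) : Finite (Code Q k r) := by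
  induction r with
  | zero => exact inferInstanceAs (Finite PUnit)
  | succ r ih => exact inferInstanceAs (Finite (Set (Q × (Fin k → Code Q k r))))

variable {Q : Type u} {k : ℕ} {M : Type z} (pat : (Fin (k + 1) → M) → Q)

/-- The code of an element: the patterns of the tuples that start with it, together with
the codes of lower rank of their entries. -/
def code : (r : ℕ) → M → Code Q (k + 1) r
  | 0, _ => PUnit.unit
  | r + 1, a => {p | ∃ e : Fin (k + 1) → M, e 0 = a ∧ p = (pat e, fun i => code r (e i))}

theorem exists_tuple_of_code_eq {r : ℕ} {a b : M} (h : code pat (r + 1) a = code pat (r + 1) b)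
    {e : Fin (k + 1) → M} (he : e 0 = a) :
    ∃ e' : Fin (k + 1) → M, e' 0 = b ∧ pat e' = pat e ∧
      ∀ i, code pat r (e' i) = code pat r (e i) := by
  have h' : {p : Q × (Fin (k + 1) → Code Q (k + 1) r) | ∃ e : Fin (k + 1) → M, e 0 = a ∧
      p = (pat e, fun i => code pat r (e i))} = {p | ∃ e : Fin (k + 1) → M, e 0 = b ∧
      p = (pat e, fun i => code pat r (e i))} := h
  obtain ⟨e', h0, h1⟩ := (Set.ext_iff.1 h' (pat e, fun i => code pat r (e i))).1 ⟨e, he, rfl⟩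
  rw [Prod.mk.injEq] at h1
  exact ⟨e', h0, h1.1.symm, fun i => (congrFun h1.2 i).symm⟩

theorem code_eq_of_le {r s : ℕ} (hrs : r ≤ s) {a b : M} (h : code pat s a = code pat s b) :
    code pat r a = code pat r b := by
  induction s, hrs using Nat.le_induction with
  | base => exact h
  | succ s _ ih =>
    -- Matching the constant tuple at `a` compares the lower codes of `a` and `b` at entry 0.
    obtain ⟨e', h0, _, h2⟩ := exists_tuple_of_code_eq pat h (e := fun _ => a) rfl
    exact ih (by rw [← h0, h2 0])

/-- Finitely many tuples represent all tuples up to pattern and codes. -/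
theorem exists_finite_representatives [Finite Q] (r : ℕ) :
    ∃ (ι : Type z) (_ : Finite ι) (bag : ι → Fin (k + 1) → M), ∀ e : Fin (k + 1) → M, ∃ b,
      pat (bag b) = pat e ∧ ∀ i, code pat r (bag b i) = code pat r (e i) := by
  let F : (Fin (k + 1) → M) → Q × (Fin (k + 1) → Code Q (k + 1) r) :=
    fun e => (pat e, fun i => code pat r (e i))
  obtain ⟨n, ⟨g⟩⟩ := Finite.exists_equiv_fin (Set.range F)
  choose bag hbag using fun j : ULift.{z} (Fin n) => (g.symm j.down).2
  refine ⟨ULift.{z} (Fin n), inferInstance, bag, fun e => ⟨⟨g ⟨F e, e, rfl⟩⟩, ?_⟩⟩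
  have h := hbag ⟨g ⟨F e, e, rfl⟩⟩
  rw [g.symm_apply_apply] at h
  have h := Prod.mk.inj h
  exact ⟨h.1, fun i => congrFun h.2 i⟩

end Codes

/-! ### Cyclic histories and their projections -/

section Cover

variable {Q : Type u} {k : ℕ} {M : Type z} (pat : (Fin (k + 1) → M) → Q) (R : ℕ) {ι : Type z}
  (bag : ι → Fin (k + 1) → M)

/-- A vertex consists of a level modulo `k + 2` and, for each level, the most recent letter of that
level in its history; consecutive letters are compatible, except at the current level, where
the history wraps around. -/
def Vertex : Type z :=
  {x : ZMod (k + 2) × (ZMod (k + 2) → ι × Fin (k + 1)) //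
    ∀ p, p ≠ x.1 → code pat R (bag (x.2 (p + 1)).1 0) = code pat R (bag (x.2 p).1 (x.2 p).2)}

variable {pat R bag}

/-- The element of `M` that a vertex copies. -/
def Vertex.elt (v : Vertex pat R bag) : M :=
  bag (v.1.2 v.1.1).1 (v.1.2 v.1.1).2

/-- The `i`-th element of the copy of the bag `b` attached to the vertex `v`. -/
def Vertex.child (v : Vertex pat R bag) (b : ι) (hb : code pat R (bag b 0) = code pat R v.elt)
    (i : Fin (k + 1)) : Vertex pat R bag :=
  if i = 0 then v else
    ⟨(v.1.1 + 1, Function.update v.1.2 (v.1.1 + 1) (b, i)), by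
      intro p hp
      simp only at hp ⊢
      rw [Function.update_of_ne hp]
      by_cases hpc : p = v.1.1
      · subst hpc
        rw [Function.update_self]
        exact hb
      · rw [Function.update_of_ne (fun h => hpc (add_right_cancel h))]
        exact v.2 p hpc⟩

@[simp]
theorem Vertex.child_zero (v : Vertex pat R bag) (b : ι)
    (hb : code pat R (bag b 0) = code pat R v.elt) : v.child b hb 0 = v :=
  if_pos rfl

theorem Vertex.child_val_of_ne (v : Vertex pat R bag) (b : ι)
    (hb : code pat R (bag b 0) = code pat R v.elt) {i : Fin (k + 1)} (hi : i ≠ 0) :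
    (v.child b hb i).1 = (v.1.1 + 1, Function.update v.1.2 (v.1.1 + 1) (b, i)) :=
  congrArg Subtype.val (if_neg hi)

theorem Vertex.code_elt_child (v : Vertex pat R bag) (b : ι)
    (hb : code pat R (bag b 0) = code pat R v.elt) (i : Fin (k + 1)) :
    code pat R (v.child b hb i).elt = code pat R (bag b i) := by
  by_cases h : i = 0
  · rw [h, Vertex.child_zero, hb]
  · simp [Vertex.elt, Vertex.child_val_of_ne v b hb h]

variable (pat bag)

open Classical in
/-- A tuple that starts with `a` and looks like the bag `b`, up to codes of rank `r`. -/
noncomputable def extend (r : ℕ) (a : M) (b : ι) : Fin (k + 1) → M :=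
  if h : code pat (r + 1) (bag b 0) = code pat (r + 1) a then
    (exists_tuple_of_code_eq pat h (e := bag b) rfl).choose
  -- Junk value: every use that matters supplies the code equality.
  else fun _ => a

theorem extend_spec {r : ℕ} {a : M} {b : ι}
    (h : code pat (r + 1) (bag b 0) = code pat (r + 1) a) :
    extend pat bag r a b 0 = a ∧ pat (extend pat bag r a b) = pat (bag b) ∧
      ∀ i, code pat r (extend pat bag r a b i) = code pat r (bag b i) := by
  unfold extend
  rw [dif_pos h]
  exact (exists_tuple_of_code_eq pat h (e := bag b) rfl).choose_spec

variable (R)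

/-- The element of `M` reached by following the letters of the history `h` at the `j` levels
after the level `l`. -/
noncomputable def follow (l : ZMod (k + 2)) (h : ZMod (k + 2) → ι × Fin (k + 1)) : ℕ → M
  | 0 => bag (h l).1 (h l).2
  | j + 1 => extend pat bag (R - (j + 1)) (follow l h j) (h (l + (j + 1 : ℕ))).1
      (h (l + (j + 1 : ℕ))).2

theorem follow_congr {l : ZMod (k + 2)} {h h' : ZMod (k + 2) → ι × Fin (k + 1)} {j : ℕ}
    (H : ∀ i ≤ j, h (l + (i : ℕ)) = h' (l + (i : ℕ))) :
    follow pat R bag l h j = follow pat R bag l h' j := by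
  induction j with
  | zero =>
    have := H 0 le_rfl
    simp only [Nat.cast_zero, add_zero] at this
    simp only [follow, this]
  | succ j ih =>
    simp only [follow]
    rw [ih fun i hi => H i (by omega), H (j + 1) le_rfl]

/-- The number of levels from `l` up to the level of `v`. -/
def Vertex.depth {pat : (Fin (k + 1) → M) → Q} {R : ℕ} {bag : ι → Fin (k + 1) → M}
    (l : ZMod (k + 2)) (v : Vertex pat R bag) : ℕ :=
  (v.1.1 - l).val

variable {R}

theorem Vertex.add_depth (l : ZMod (k + 2)) (v : Vertex pat R bag) :
    l + (v.depth l : ℕ) = v.1.1 := by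
  simp [Vertex.depth]

theorem Vertex.depth_lt (l : ZMod (k + 2)) (v : Vertex pat R bag) : v.depth l < k + 2 :=
  ZMod.val_lt _

theorem add_cast_injective (l : ZMod (k + 2)) {i j : ℕ} (hi : i < k + 2) (hj : j < k + 2)
    (h : l + (i : ZMod (k + 2)) = l + j) : i = j := by
  have := congrArg ZMod.val (add_left_cancel h)
  rwa [ZMod.val_cast_of_lt hi, ZMod.val_cast_of_lt hj] at this

/-- Up to the level of `v` the trace never crosses the wrap-around, so compatibility applies at each
step, and each `extend` spends one rank. -/
theorem Vertex.code_follow (hR : k + 2 ≤ R) (l : ZMod (k + 2)) (v : Vertex pat R bag) {j : ℕ}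
    (hj : j ≤ v.depth l) :
    code pat (R - j) (follow pat R bag l v.1.2 j) =
      code pat (R - j) (bag (v.1.2 (l + (j : ℕ))).1 (v.1.2 (l + (j : ℕ))).2) := by
  have hd := v.depth_lt pat bag l
  induction j with
  | zero => simp [follow]
  | succ j ih =>
    have h := v.2 (l + (j : ℕ)) fun h => by
      rw [← v.add_depth pat bag l] at h
      have := add_cast_injective l (by omega) hd h
      omega
    have h' := (code_eq_of_le pat (Nat.sub_le R j) h).trans (ih (by omega)).symm
    rw [show R - j = R - (j + 1) + 1 by omega] at h'
    have := (extend_spec pat bag h').2.2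
    rw [add_assoc, ← Nat.cast_succ] at this
    exact this _

/-- The copy of a vertex in `M`, obtained by following its history from the level `l`. -/
noncomputable def Vertex.proj (l : ZMod (k + 2)) (v : Vertex pat R bag) : M :=
  follow pat R bag l v.1.2 (v.depth l)

theorem Vertex.code_proj (hR : k + 2 ≤ R) (l : ZMod (k + 2)) (v : Vertex pat R bag) :
    code pat (R - v.depth l) (v.proj pat bag l) = code pat (R - v.depth l) v.elt := by
  have := v.code_follow pat bag hR l le_rfl
  rwa [v.add_depth pat bag l] at this

/-- All children in one bag copy share the trace of `v`, so they land in one `extend` tuple. Only a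
child at level `l` restarts the trace. -/
theorem Vertex.exists_proj_child (hR : k + 2 ≤ R) (l : ZMod (k + 2)) (v : Vertex pat R bag)
    (b : ι) (hb : code pat R (bag b 0) = code pat R v.elt) :
    ∃ e : Fin (k + 1) → M, pat e = pat (bag b) ∧
      ∀ i, (v.child b hb i).1.1 ≠ l → (v.child b hb i).proj pat bag l = e i := by
  have hd := v.depth_lt pat bag l
  have hs : R - v.depth l = R - (v.depth l + 1) + 1 := by omega
  have h := (code_eq_of_le pat (Nat.sub_le R _) hb).trans (v.code_proj pat bag hR l).symm
  rw [hs] at h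
  obtain ⟨h0, h1, -⟩ := extend_spec pat bag h
  refine ⟨_, h1, fun i hi => ?_⟩
  by_cases hi0 : i = 0
  · rw [hi0, Vertex.child_zero, h0]
  have hval := v.child_val_of_ne b hb hi0
  have hc := v.add_depth pat bag l
  have hlt : v.depth l + 1 < k + 2 := by
    refine lt_of_le_of_ne hd fun hE => hi ?_
    rw [hval, ← hc, add_assoc, ← Nat.cast_succ, Nat.succ_eq_add_one, hE]
    simp
  have hdc : (v.child b hb i).depth l = v.depth l + 1 := by
    apply add_cast_injective l (Vertex.depth_lt pat bag l _) hlt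
    rw [Vertex.add_depth, hval, ← hc]
    push_cast
    ring
  have hl : l + ((v.depth l + 1 : ℕ) : ZMod (k + 2)) = v.1.1 + 1 := by
    rw [← hc]
    push_cast
    ring
  -- The overwritten level lies just beyond those followed to reach `v`.
  have hf : follow pat R bag l (Function.update v.1.2 (v.1.1 + 1) (b, i)) (v.depth l) =
      follow pat R bag l v.1.2 (v.depth l) := by
    refine follow_congr pat R bag fun j hj => Function.update_of_ne (fun hE => ?_) _ _
    have := add_cast_injective l (by omega) hlt (hE.trans hl.symm)
    omega
  unfold Vertex.proj
  rw [hdc, hval]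
  simp only [follow]
  rw [hl, Function.update_self, hf]

end Cover

/-! ### The finite model -/

section Model

variable {L : FirstOrder.Language.{u, v}} (σ : Set (Σ n, L.Relations n)) {M : Type z}
  [L.Structure M] {k : ℕ}

/-- The relations in `σ` that hold between entries of a tuple. -/
def pattern (k : ℕ) (e : Fin (k + 1) → M) : Set (Σ R : σ, Fin R.1.1 → Fin (k + 1)) :=
  {p | Structure.RelMap p.1.1.2 (e ∘ p.2)}

theorem relMap_comp_of_pattern_eq {A : Type z} [L.Structure A] {e e' : Fin (k + 1) → A}
    (h : pattern σ k e' = pattern σ k e) {R : Σ n, L.Relations n} (hR : R ∈ σ)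
    {y : Fin R.1 → Fin (k + 1)} (hy : Structure.RelMap R.2 (e ∘ y)) :
    Structure.RelMap R.2 (e' ∘ y) := by
  have : (⟨⟨R, hR⟩, y⟩ : Σ R : σ, Fin R.1.1 → Fin (k + 1)) ∈ pattern σ k e := hy
  rw [← h] at this
  exact this

/-- A tuple of length `k + 1` that starts with a given element and lists a set of at most `k`
elements, together with an indexing of the set by the tuple. -/
theorem exists_tuple_listing {A : Type z} (a : A) (s : Finset A) (hs : s.card ≤ k) :
    ∃ (e : Fin (k + 1) → A) (f : A → Fin (k + 1)), e 0 = a ∧ f a = 0 ∧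
      ∀ x ∈ s, e (f x) = x := by
  classical
  have e₀ := s.equivFin
  let f : A → Fin (k + 1) := fun x =>
    if x = a then 0 else if hx : x ∈ s then (Fin.castLE hs (e₀ ⟨x, hx⟩)).succ else 0
  let e : Fin (k + 1) → A :=
    Fin.cons a fun i => if hi : i.1 < s.card then (e₀.symm ⟨i, hi⟩ : A) else a
  refine ⟨e, f, rfl, if_pos rfl, fun x hx => ?_⟩
  by_cases hxa : x = a
  · simp [f, e, hxa]
  · simp [f, e, hxa, hx]

variable {σ} {R : ℕ} {ι : Type z} {bag : ι → Fin (k + 1) → M}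

/-- No facts hold beyond those copied from bags, so a map out is checked one bag copy at a time. -/
instance Vertex.structure [L.IsRelational] : L.Structure (Vertex (pattern σ k) R bag) where
  funMap f := isEmptyElim f
  RelMap {n} r x := ∃ (v : Vertex (pattern σ k) R bag) (b : ι)
    (hb : code (pattern σ k) R (bag b 0) = code (pattern σ k) R v.elt) (y : Fin n → Fin (k + 1)),
    x = v.child b hb ∘ y ∧ Structure.RelMap r (bag b ∘ y)

theorem Vertex.homOn_proj [L.IsRelational] (hR : k + 2 ≤ R) (l : ZMod (k + 2)) :
    HomOn σ {v : Vertex (pattern σ k) R bag | v.1.1 ≠ l} (Vertex.proj (pattern σ k) bag l) := by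
  rintro r hr x hx ⟨v, b, hb, y, rfl, hy⟩
  obtain ⟨e, he, h⟩ := v.exists_proj_child (pattern σ k) bag hR l b hb
  have := relMap_comp_of_pattern_eq σ he hr hy
  convert this using 1
  funext t
  exact h _ (hx t)

theorem exists_missed_level (v : Vertex (pattern σ k) R bag)
    (s : Finset (Vertex (pattern σ k) R bag)) (hs : s.card ≤ k) :
    ∃ l : ZMod (k + 2), v.1.1 ≠ l ∧ ∀ x ∈ s, x.1.1 ≠ l := by
  classical
  obtain ⟨l, hl⟩ : ∃ l, l ∉ (insert v s).image fun x => x.1.1 := by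
    by_contra! h
    have h1 := Finset.card_le_card (fun l _ => h l :
      (Finset.univ : Finset (ZMod (k + 2))) ⊆ (insert v s).image fun x => x.1.1)
    have h2 : ((insert v s).image fun x => x.1.1).card ≤ (insert v s).card :=
      Finset.card_image_le
    have h3 := Finset.card_insert_le v s
    rw [Finset.card_univ, ZMod.card] at h1
    omega
  simp only [Finset.mem_image, not_exists, not_and] at hl
  exact ⟨l, hl v (by simp), fun x hx => hl x (by simp [hx])⟩

/-- Forth: a matching tuple of `M` is represented by a bag, attached at `v`. Back: vertices avoiding
a level project to `M`, and the resulting tuple is moved to start at `a`. Depth is at most `k + 1`,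
so rank at least `r₀ + 1` survives projection. -/
theorem Vertex.sim [L.IsRelational] {r₀ : ℕ} (hR : R = r₀ + k + 2)
    (hbag : ∀ e : Fin (k + 1) → M, ∃ b, pattern σ k (bag b) = pattern σ k e ∧
      ∀ i, code (pattern σ k) R (bag b i) = code (pattern σ k) R (e i)) {r : ℕ} (hr : r ≤ r₀) :
    ∀ (a : M) (v : Vertex (pattern σ k) R bag),
      code (pattern σ k) r v.elt = code (pattern σ k) r a →
        Sim σ k M (Vertex (pattern σ k) R bag) r a v := by
  induction r with
  | zero => intros; trivial
  | succ r ih =>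
    intro a v h
    refine ⟨fun s hs => ?_, fun s hs => ?_⟩
    · obtain ⟨e, f, he, hf, hef⟩ := exists_tuple_listing a s hs
      obtain ⟨e', h0, h1, h2⟩ := exists_tuple_of_code_eq (pattern σ k) h.symm he
      obtain ⟨b, hb, hb'⟩ := hbag e'
      have hb0 : code (pattern σ k) R (bag b 0) = code (pattern σ k) R v.elt := by rw [hb' 0, h0]
      refine ⟨v.child b hb0 ∘ f, by simp [hf], ?_, fun x hx => ?_⟩
      · intro S hS x hx hSx
        refine ⟨v, b, hb0, f ∘ x, rfl, relMap_comp_of_pattern_eq σ (hb.trans h1) hS ?_⟩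
        convert hSx using 1
        funext t
        exact hef _ (hx t)
      · refine ih (by omega) _ _ (Eq.trans (b := code (pattern σ k) r (bag b (f x))) ?_ ?_)
        · exact code_eq_of_le _ (by omega) (v.code_elt_child b hb0 (f x))
        · rw [code_eq_of_le _ (by omega) (hb' (f x)), h2, hef x hx]
    · obtain ⟨l, hlv, hls⟩ := exists_missed_level v s hs
      have hproj (x : Vertex (pattern σ k) R bag) : code (pattern σ k) (r + 1)
          (x.proj (pattern σ k) bag l) = code (pattern σ k) (r + 1) x.elt :=
        code_eq_of_le _ (by have := x.depth_lt (pattern σ k) bag l; omega)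
          (x.code_proj (pattern σ k) bag (by omega) l)
      obtain ⟨e, f, he, hf, hef⟩ := exists_tuple_listing v s hs
      obtain ⟨e', h0, h1, h2⟩ := exists_tuple_of_code_eq (pattern σ k) ((hproj v).trans h)
        (e := Vertex.proj (pattern σ k) bag l ∘ e) (by simp [he])
      refine ⟨e' ∘ f, by simp [hf, h0], ?_, fun x hx => ?_⟩
      · intro S hS x hx hSx
        refine relMap_comp_of_pattern_eq σ (y := f ∘ x) h1 hS ?_
        convert Vertex.homOn_proj (by omega) l S hS x (fun t => hls _ (hx t)) hSx using 1
        funext t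
        simp [hef _ (hx t)]
      · refine ih (by omega) _ _ ?_
        simp only [Function.comp_apply]
        rw [h2, Function.comp_apply, hef x hx]
        exact (code_eq_of_le _ (Nat.le_succ r) (hproj x)).symm

theorem exists_finite_sim [L.IsRelational] (hσ : σ.Finite) (k r : ℕ) (a : M) :
    ∃ (N : Type z) (_ : L.Structure N) (_ : Finite N) (b : N), Sim σ k M N r a b := by
  have := hσ.to_subtype
  obtain ⟨ι, _, bag, hbag⟩ :=
    exists_finite_representatives (pattern (M := M) σ k) (r + k + 2)
  obtain ⟨b, hb, hb'⟩ := hbag fun _ => a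
  have : Finite (Vertex (pattern σ k) (r + k + 2) bag) := by
    unfold Vertex
    infer_instance
  let v : Vertex (pattern σ k) (r + k + 2) bag := ⟨(0, fun _ => (b, 0)), fun _ _ => rfl⟩
  exact ⟨Vertex (pattern σ k) (r + k + 2) bag, inferInstance, this, v,
    Vertex.sim rfl hbag le_rfl a v (code_eq_of_le _ (by omega) (hb' 0))⟩

/-- Transport to `Fin n` brings the model down to `Type`. -/
theorem hasFiniteModel_of_finite {α : Type w} {φ : L.Formula α} {N : Type z} [L.Structure N]
    [Finite N] [Nonempty N] {v : α → N} (h : φ.Realize v) : HasFiniteModel φ := by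
  obtain ⟨n, ⟨g⟩⟩ := Finite.exists_equiv_fin N
  let _ : L.Structure (Fin n) := g.inducedStructure
  exact ⟨Fin n, inferInstance, ⟨g (Classical.arbitrary N)⟩, inferInstance, g ∘ v,
    (StrongHomClass.realize_formula g.inducedStructureEquiv φ).2 h⟩

end Model

end UNFO

theorem mainTheorem3 {L : FirstOrder.Language.{u, v}} [L.IsRelational] {α : Type w}
    (φ : L.Formula α) (hφ : UNFO.IsUNFO φ) (hsat : UNFO.IsSatisfiable.{u, v, w, z} φ) :
    UNFO.HasFiniteModel φ := by
  obtain ⟨M, _, _, a, ha⟩ := hsat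
  obtain ⟨K, r, σ, hσ, h⟩ := hφ.exists_witness
  -- The starting element is immaterial: the extra first round supplies the map on the witness set.
  obtain ⟨N, _, _, b, hb⟩ := UNFO.exists_finite_sim hσ K (r + 1) (Classical.arbitrary M)
  obtain ⟨s, hs, H⟩ := h K le_rfl r le_rfl σ subset_rfl M N a _ ha
  obtain ⟨g, -, hg, hg'⟩ := hb.1 s hs
  have : Nonempty N := ⟨b⟩
  have := H g hg hg'
  rw [Subsingleton.elim (g ∘ default) default] at this
  exact UNFO.hasFiniteModel_of_finite this
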